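/- Let $G=(U,V;E)$ be a finite simple bipartite graph with sides $U$ and $V$, each having $n \ge 1$ vertices. Given a permutation $\sigma$ of $U$ and a permutation $\pi$ of $V$, the greedy matching $M_G[\sigma,\pi]$ is obtained as follows: the vertices of $U$ arrive in the order $\sigma$, and each arriving vertex $u$ is matched to its neighbor $v\in V$ that comes first in $\pi$ among the neighbors of $u$ not yet matched; if all neighbors of $u$ are already matched, $u$ is left unmatched. Let $$\rho[G] = \frac1n \max_{\pi}\min_{\sigma} \bigl|M_G[\sigma,\pi]\bigr|,$$ where $\pi$ ranges over all permutations of $V$ and $\sigma$ over all permutations of $U$. **Theorem.** There is an absolute constant $C>0$ such that for every integer $d\ge 1$ and every finite $d$-regular simple bipartite graph $G$ with $n \ge 1$ vertices on each side, $$\rho[G] \;\ge\; \frac59 - \frac{C}{\sqrt d}.$$ -/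

import Mathlib

/-!
Max-min greedy matching.  A bipartite graph with sides `U` and `V` is a simple graph `G` on the
disjoint union `U ⊕ V` with `G ≤ completeBipartiteGraph U V`.  A permutation of `V` is a
bijection `π : Fin (Fintype.card V) ≃ V`, where `π i` is the vertex in position `i`, and
likewise for `U`.
-/

open Classical in
/-- One step of the greedy algorithm: `M` is the set of pairs matched so far, and `u` arrives.
If `u` has a neighbor in `V` that is not matched by `M`, then `u` is matched to the lowest such
neighbor under `π`; otherwise `u` is left unmatched. -/
noncomputable def greedyStep {U V : Type*} [Fintype V] (G : SimpleGraph (U ⊕ V))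
    (π : Fin (Fintype.card V) ≃ V) (M : Finset (U × V)) (u : U) : Finset (U × V) :=
  let I : Finset (Fin (Fintype.card V)) :=
    {i | G.Adj (Sum.inl u) (Sum.inr (π i)) ∧ ∀ e ∈ M, e.2 ≠ π i}
  if h : I.Nonempty then insert (u, π (I.min' h)) M else M

/-- The greedy matching `M_G[σ, π]`: the vertices of `U` arrive in the order
`σ 0, σ 1, …`, starting from the empty matching. -/
noncomputable def greedyMatching {U V : Type*} [Fintype U] [Fintype V] (G : SimpleGraph (U ⊕ V))
    (σ : Fin (Fintype.card U) ≃ U) (π : Fin (Fintype.card V) ≃ V) : Finset (U × V) :=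
  (List.ofFn σ).foldl (greedyStep G π) ∅

/-- The ratio `ρ[G] = (1 / n) * max_π min_σ |M_G[σ, π]|`, where `n` is the number of vertices of
a side.  The supremum and the infimum are over finite nonempty types and are attained. -/
noncomputable def maxMinGreedyRatio {U V : Type*} [Fintype U] [Fintype V]
    (G : SimpleGraph (U ⊕ V)) : ℝ :=
  (1 / (Fintype.card V : ℝ)) *
    ((⨆ π : Fin (Fintype.card V) ≃ V, ⨅ σ : Fin (Fintype.card U) ≃ U,
      (greedyMatching G σ π).card : ℕ) : ℝ)

/-!
The permutation `π` lists first one half of a partition `V = V₁ ∪ V₂` which nearly halves the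
neighborhood of a typical vertex of `U`.  Such a partition exists by choosing signs
`ε : V → {1, -1}` one vertex at a time so that `∑ u, (∑ v ∼ u, ε v) ^ 2 ≤ n d`
(`exists_signs_sum_sq_le`); by Cauchy–Schwarz the total discrepancy `∑ u, |∑ v ∼ u, ε v|` is then
at most `n √d`.

Whatever the arrival order `σ` is, every neighbor of an unmatched vertex `v` ends up matched to a
vertex preceding `v` in `π` (`exists_mem_greedyMatching_lt`).  Hence the `t₁` unmatched vertices
of `V₁` send their `d t₁` edges into the at most `|V₁| - t₁` vertices of `U` that are matched into
`V₁`, each of which absorbs about `d / 2` of them, and the `t₂` unmatched vertices of `V₂` send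
their edges into the at most `n - t₁ - t₂` matched vertices of `U`.  Up to errors of order
`n / √d`, this reads `t₁ ≤ (n / 2 - t₁) / 2` and `t₂ ≤ (n - t₁ - t₂) / 2`, so that
`t₁ + t₂ ≤ 4 n / 9` (`card_greedyMatching_ge`).
-/

/-! ### Balanced signs and sorted positions -/

/-- Signs for the columns of a real matrix can be chosen so that the signed row sums have total
square at most the sum of the squares of all entries. -/
theorem exists_signs_sum_sq_le {U V : Type*} [Fintype U] (w : U → V → ℝ) (A : Finset V) :
    ∃ ε : V → ℝ, (∀ v, ε v = 1 ∨ ε v = -1) ∧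
      ∑ u, (∑ v ∈ A, w u v * ε v) ^ 2 ≤ ∑ u, ∑ v ∈ A, w u v ^ 2 := by
  classical
  induction A using Finset.induction_on with
  | empty => exact ⟨fun _ => 1, fun _ => Or.inl rfl, by simp⟩
  | insert a A ha ih =>
    obtain ⟨ε, hε, hle⟩ := ih
    -- The sign of the new column is the one that makes the cross term nonpositive.
    obtain ⟨s, hs, hcross⟩ : ∃ s : ℝ, (s = 1 ∨ s = -1) ∧
        s * ∑ u, w u a * ∑ v ∈ A, w u v * ε v ≤ 0 := by
      rcases le_total (∑ u, w u a * ∑ v ∈ A, w u v * ε v) 0 with h | h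
      · exact ⟨1, Or.inl rfl, by linarith⟩
      · exact ⟨-1, Or.inr rfl, by linarith⟩
    refine ⟨Function.update ε a s, fun v => ?_, ?_⟩
    · rcases eq_or_ne v a with rfl | hv
      · simpa using hs
      · simpa [hv] using hε v
    have hrow : ∀ u, ∑ v ∈ insert a A, w u v * Function.update ε a s v
        = w u a * s + ∑ v ∈ A, w u v * ε v := by
      intro u
      rw [Finset.sum_insert ha, Function.update_self]
      congr 1
      refine Finset.sum_congr rfl fun v hv => ?_
      rw [Function.update_of_ne (ne_of_mem_of_not_mem hv ha)]
    have hs2 : s ^ 2 = 1 := by rcases hs with rfl | rfl <;> norm_num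
    calc ∑ u, (∑ v ∈ insert a A, w u v * Function.update ε a s v) ^ 2
        = ∑ u, (w u a ^ 2 + 2 * s * (w u a * ∑ v ∈ A, w u v * ε v)
            + (∑ v ∈ A, w u v * ε v) ^ 2) := by
          refine Finset.sum_congr rfl fun u _ => ?_
          rw [hrow]
          linear_combination w u a ^ 2 * hs2
      _ = ∑ u, w u a ^ 2 + 2 * (s * ∑ u, w u a * ∑ v ∈ A, w u v * ε v)
            + ∑ u, (∑ v ∈ A, w u v * ε v) ^ 2 := by
          rw [Finset.sum_add_distrib, Finset.sum_add_distrib, ← Finset.mul_sum, mul_assoc]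
      _ ≤ ∑ u, w u a ^ 2 + ∑ u, ∑ v ∈ A, w u v ^ 2 := by linarith
      _ = ∑ u, ∑ v ∈ insert a A, w u v ^ 2 := by
          simp [Finset.sum_insert ha, Finset.sum_add_distrib]

theorem exists_equiv_monotone_comp {V α : Type*} [Fintype V] [LinearOrder α] (c : V → α) :
    ∃ π : Fin (Fintype.card V) ≃ V, Monotone (c ∘ π) :=
  ⟨(Tuple.sort (c ∘ (Fintype.equivFin V).symm)).trans (Fintype.equivFin V).symm,
    Tuple.monotone_sort (c ∘ (Fintype.equivFin V).symm)⟩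

/-! ### The greedy matching -/

section Greedy

variable {U V : Type*} [Fintype V] (G : SimpleGraph (U ⊕ V)) (π : Fin (Fintype.card V) ≃ V)

open Classical in
theorem greedyStep_spec (M : Finset (U × V)) (u : U) :
    (∃ i, (∀ e ∈ M, e.2 ≠ π i) ∧
        (∀ j, G.Adj (Sum.inl u) (Sum.inr (π j)) → (∀ e ∈ M, e.2 ≠ π j) → i ≤ j) ∧
        greedyStep G π M u = insert (u, π i) M) ∨
      ((∀ j, G.Adj (Sum.inl u) (Sum.inr (π j)) → ∃ e ∈ M, e.2 = π j) ∧
        greedyStep G π M u = M) := by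
  unfold greedyStep
  extract_lets I
  by_cases h : I.Nonempty
  · left
    have hmem := I.min'_mem h
    refine ⟨I.min' h, (Finset.mem_filter.1 hmem).2.2, fun j hj hj' => ?_, by simp [h]⟩
    exact I.min'_le j (Finset.mem_filter.2 ⟨Finset.mem_univ _, hj, hj'⟩)
  · right
    refine ⟨fun j hj => ?_, by simp [h]⟩
    by_contra! hcon
    exact h ⟨j, Finset.mem_filter.2 ⟨Finset.mem_univ _, hj, hcon⟩⟩

theorem subset_greedyStep (M : Finset (U × V)) (u : U) : M ⊆ greedyStep G π M u := by
  classical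
  rcases greedyStep_spec G π M u with ⟨i, -, -, h⟩ | ⟨-, h⟩
  · rw [h]
    intro e he
    simp [he]
  · rw [h]

theorem subset_foldl_greedyStep (l : List U) (M : Finset (U × V)) :
    M ⊆ l.foldl (greedyStep G π) M := by
  induction l generalizing M with
  | nil => simp
  | cons u l ih => exact (subset_greedyStep G π M u).trans (ih _)

theorem injOn_snd_greedyStep (M : Finset (U × V)) (u : U)
    (hM : Set.InjOn Prod.snd (M : Set (U × V))) :
    Set.InjOn Prod.snd (greedyStep G π M u : Set (U × V)) := by
  classical
  rcases greedyStep_spec G π M u with ⟨i, hi, -, h⟩ | ⟨-, h⟩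
  · rw [h]
    intro e he f hf hef
    simp only [Finset.coe_insert, Set.mem_insert_iff, Finset.mem_coe] at he hf
    rcases he with rfl | he <;> rcases hf with rfl | hf
    · rfl
    · exact absurd hef.symm (hi f hf)
    · exact absurd hef (hi e he)
    · exact hM he hf hef
  · rwa [h]

theorem injOn_snd_foldl_greedyStep (l : List U) (M : Finset (U × V))
    (hM : Set.InjOn Prod.snd (M : Set (U × V))) :
    Set.InjOn Prod.snd ((l.foldl (greedyStep G π) M : Finset (U × V)) : Set (U × V)) := by
  induction l generalizing M with
  | nil => exact hM
  | cons u l ih => exact ih _ (injOn_snd_greedyStep G π M u hM)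

theorem exists_mem_foldl_greedyStep_lt (l : List U) (M : Finset (U × V)) {u : U} (hu : u ∈ l)
    {v : V} (huv : G.Adj (Sum.inl u) (Sum.inr v))
    (hv : ∀ e ∈ l.foldl (greedyStep G π) M, e.2 ≠ v) :
    ∃ v', (u, v') ∈ l.foldl (greedyStep G π) M ∧ π.symm v' < π.symm v := by
  classical
  induction l generalizing M with
  | nil => simp at hu
  | cons u' l ih =>
    rw [List.foldl_cons] at hv ⊢
    rcases List.mem_cons.1 hu with rfl | hu
    · have hsub := subset_foldl_greedyStep G π l (greedyStep G π M u)
      have hvM : ∀ e ∈ M, e.2 ≠ v :=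
        fun e he => hv e (hsub (subset_greedyStep G π M u he))
      rcases greedyStep_spec G π M u with ⟨i, -, hmin, h⟩ | ⟨hfull, -⟩
      · have hmem : (u, π i) ∈ l.foldl (greedyStep G π) (greedyStep G π M u) :=
          hsub (by rw [h]; exact Finset.mem_insert_self _ _)
        refine ⟨π i, hmem, ?_⟩
        have hle : i ≤ π.symm v := hmin _ (by simpa using huv) (by simpa using hvM)
        rw [Equiv.symm_apply_apply]
        refine lt_of_le_of_ne hle fun hi => hv _ hmem ?_
        simp [hi]
      · obtain ⟨e, he, hev⟩ := hfull (π.symm v) (by simpa using huv)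
        exact absurd (by simpa using hev) (hvM e he)
    · exact ih _ hu hv

variable [Fintype U] (σ : Fin (Fintype.card U) ≃ U)

theorem injOn_snd_greedyMatching :
    Set.InjOn Prod.snd (greedyMatching G σ π : Set (U × V)) :=
  injOn_snd_foldl_greedyStep G π _ ∅ (by simp)

/-- Every neighbor of a vertex `v` left unmatched is matched to a vertex preceding `v`. -/
theorem exists_mem_greedyMatching_lt {u : U} {v : V}
    (huv : G.Adj (Sum.inl u) (Sum.inr v)) (hv : ∀ e ∈ greedyMatching G σ π, e.2 ≠ v) :
    ∃ v', (u, v') ∈ greedyMatching G σ π ∧ π.symm v' < π.symm v :=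
  exists_mem_foldl_greedyStep_lt G π _ ∅
    ((List.mem_ofFn' _ _).2 ⟨σ.symm u, by simp⟩) huv hv

end Greedy

/-! ### Edge counting in regular bipartite graphs -/

open Classical in
theorem sum_adj_right_eq_degree {U V : Type*} [Fintype V] {G : SimpleGraph (U ⊕ V)}
    [G.LocallyFinite] (hG : G ≤ completeBipartiteGraph U V) (u : U) :
    ∑ v : V, (if G.Adj (Sum.inl u) (Sum.inr v) then (1 : ℝ) else 0) = G.degree (Sum.inl u) := by
  rw [Finset.sum_boole, ← SimpleGraph.card_neighborFinset_eq_degree,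
    ← Finset.card_map Function.Embedding.inr]
  congr 2
  ext x
  rcases x with x | x
  · have : ¬ G.Adj (Sum.inl u) (Sum.inl x) := fun h => by simpa using hG h
    simp [this]
  · simp

open Classical in
theorem sum_adj_left_eq_degree {U V : Type*} [Fintype U] {G : SimpleGraph (U ⊕ V)}
    [G.LocallyFinite] (hG : G ≤ completeBipartiteGraph U V) (v : V) :
    ∑ u : U, (if G.Adj (Sum.inl u) (Sum.inr v) then (1 : ℝ) else 0) = G.degree (Sum.inr v) := by
  rw [Finset.sum_boole, ← SimpleGraph.card_neighborFinset_eq_degree,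
    ← Finset.card_map Function.Embedding.inl]
  congr 2
  ext x
  rcases x with x | x
  · simp [G.adj_comm]
  · have : ¬ G.Adj (Sum.inr v) (Sum.inr x) := fun h => by simpa using hG h
    simp [this]

/-- If all neighbors of `T ⊆ W` lie in `X`, and the vertices of `X` have at most
`d / 2 + D u` neighbors in `W`, then counting the edges at `T` bounds the size of `T`. -/
theorem card_mul_le_of_neighbors_subset {U V : Type*} [Fintype U] (a : U → V → ℝ)
    (ha : ∀ u v, 0 ≤ a u v) {d : ℝ} (hd : ∀ v, ∑ u, a u v = d) {D : U → ℝ} (hD : ∀ u, 0 ≤ D u)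
    {T W : Finset V} {X : Finset U} (hTW : T ⊆ W) (hX : ∀ u ∉ X, ∀ v ∈ T, a u v = 0)
    (hW : ∀ u, ∑ v ∈ W, a u v ≤ d / 2 + D u) :
    (T.card : ℝ) * d ≤ X.card * (d / 2) + ∑ u, D u :=
  calc (T.card : ℝ) * d = ∑ v ∈ T, ∑ u, a u v := by simp [hd]
    _ = ∑ v ∈ T, ∑ u ∈ X, a u v := by
        refine Finset.sum_congr rfl fun v hv => (Finset.sum_subset (Finset.subset_univ X) ?_).symm
        exact fun u _ hu => hX u hu v hv
    _ = ∑ u ∈ X, ∑ v ∈ T, a u v := Finset.sum_comm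
    _ ≤ ∑ u ∈ X, (d / 2 + D u) := Finset.sum_le_sum fun u _ =>
        (Finset.sum_le_sum_of_subset_of_nonneg hTW fun v _ _ => ha u v).trans (hW u)
    _ = X.card * (d / 2) + ∑ u ∈ X, D u := by
        rw [Finset.sum_add_distrib, Finset.sum_const, nsmul_eq_mul]
    _ ≤ X.card * (d / 2) + ∑ u, D u := by
        gcongr
        · exact fun u _ _ => hD u
        · exact Finset.subset_univ X

/-- Let `W` be an initial segment of `π` such that every vertex `u` has at most `d / 2 + D u`
neighbors in `W` and at most that many outside `W`.  Then every greedy matching with respect to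
`π` misses at most a fraction `4 / 9` of `V`, up to an error given by the total of `D`. -/
theorem card_greedyMatching_ge {U V : Type*} [Fintype U] [Fintype V] {G : SimpleGraph (U ⊕ V)}
    (a : U → V → ℝ) (ha : ∀ u v, 0 ≤ a u v)
    (haG : ∀ u v, ¬ G.Adj (Sum.inl u) (Sum.inr v) → a u v = 0) {d : ℝ} (hd0 : 0 < d)
    (hd : ∀ v, ∑ u, a u v = d) (hcard : Fintype.card U = Fintype.card V)
    {D : U → ℝ} (hD : ∀ u, 0 ≤ D u) {W W' : Finset V} (hWW' : ∀ v, v ∈ W' ↔ v ∉ W)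
    (hW : ∀ u, ∑ v ∈ W, a u v ≤ d / 2 + D u) (hW' : ∀ u, ∑ v ∈ W', a u v ≤ d / 2 + D u)
    {π : Fin (Fintype.card V) ≃ V} (hπ : ∀ i j, i ≤ j → π j ∈ W → π i ∈ W)
    (σ : Fin (Fintype.card U) ≃ U) :
    5 / 9 * (Fintype.card V : ℝ) - 4 / 3 * ((∑ u, D u) / d) ≤ (greedyMatching G σ π).card := by
  classical
  set M := greedyMatching G σ π with hM
  set S := M.image Prod.snd with hS
  have hunmatched : ∀ {v}, v ∉ S → ∀ e ∈ M, e.2 ≠ v :=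
    fun hv e he hev => hv (hev ▸ Finset.mem_image_of_mem _ he)
  have hSM : S.card ≤ M.card := Finset.card_image_le
  have hM₁ : ((M.filter (·.2 ∈ W)).image Prod.fst).card ≤ (S ∩ W).card := by
    refine Finset.card_image_le.trans ?_
    rw [← Finset.card_image_of_injOn (s := M.filter (·.2 ∈ W)) (f := Prod.snd)
      ((injOn_snd_greedyMatching G π σ).mono (by intro e he; simp at he; exact he.1))]
    refine Finset.card_le_card fun v hv => ?_
    obtain ⟨e, he, rfl⟩ := Finset.mem_image.1 hv
    rw [Finset.mem_filter] at he
    exact Finset.mem_inter.2 ⟨Finset.mem_image_of_mem _ he.1, he.2⟩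
  have hM₂ : (M.image Prod.fst).card ≤ M.card := Finset.card_image_le
  have h₁ := card_mul_le_of_neighbors_subset (T := W \ S)
    (X := (M.filter (·.2 ∈ W)).image Prod.fst) a ha hd hD Finset.sdiff_subset ?_ hW
  have h₂ := card_mul_le_of_neighbors_subset (T := W' \ S)
    (X := M.image Prod.fst) a ha hd hD Finset.sdiff_subset ?_ hW'
  have h₀ := card_mul_le_of_neighbors_subset (T := W) (X := Finset.univ)
    a ha hd hD subset_rfl (by simp) hW
  · have hWS : (W \ S).card + (S ∩ W).card = W.card := by
      rw [Finset.inter_comm]; exact Finset.card_sdiff_add_card_inter W S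
    have hVS : (W \ S).card + (W' \ S).card + S.card = Fintype.card V := by
      rw [← Finset.card_union_of_disjoint, ← Finset.card_union_of_disjoint,
        ← Finset.card_univ]
      · congr 1
        ext v
        simp only [Finset.mem_union, Finset.mem_sdiff, hWW', Finset.mem_univ, iff_true]
        tauto
      · rw [Finset.disjoint_left]
        intro v hv
        simp only [Finset.mem_union, Finset.mem_sdiff] at hv
        tauto
      · rw [Finset.disjoint_left]
        intro v hv
        simp only [Finset.mem_sdiff, hWW'] at hv ⊢
        tauto
    have hM₁' : ((((M.filter (·.2 ∈ W)).image Prod.fst).card : ℕ) : ℝ) ≤ (S ∩ W).card := by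
      exact_mod_cast hM₁
    have hM₂' : (((M.image Prod.fst).card : ℕ) : ℝ) ≤ M.card := by exact_mod_cast hM₂
    have hSM' : (S.card : ℝ) ≤ M.card := by exact_mod_cast hSM
    have hWS' : ((W \ S).card : ℝ) + (S ∩ W).card = W.card := by exact_mod_cast hWS
    have hVS' : ((W \ S).card : ℝ) + (W' \ S).card + S.card = Fintype.card V := by
      exact_mod_cast hVS
    rw [Finset.card_univ, hcard] at h₀
    set E := (∑ u, D u) / d with hE
    have hEd : ∑ u, D u = E * d := by rw [hE]; field_simp
    rw [hEd] at h₀ h₁ h₂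
    replace h₀ : (W.card : ℝ) ≤ Fintype.card V / 2 + E :=
      le_of_mul_le_mul_right (by linarith) hd0
    replace h₁ : ((W \ S).card : ℝ) ≤
        ((M.filter (·.2 ∈ W)).image Prod.fst).card / 2 + E :=
      le_of_mul_le_mul_right (by linarith) hd0
    replace h₂ : ((W' \ S).card : ℝ) ≤ (M.image Prod.fst).card / 2 + E :=
      le_of_mul_le_mul_right (by linarith) hd0
    linarith
  · intro u hu v hv
    rw [Finset.mem_sdiff] at hv
    refine haG u v fun huv => hu ?_
    obtain ⟨v', hv', -⟩ := exists_mem_greedyMatching_lt G π σ huv (hunmatched hv.2)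
    exact Finset.mem_image_of_mem _ hv'
  · intro u hu v hv
    rw [Finset.mem_sdiff] at hv
    refine haG u v fun huv => hu ?_
    obtain ⟨v', hv', hlt⟩ := exists_mem_greedyMatching_lt G π σ huv (hunmatched hv.2)
    refine Finset.mem_image.2 ⟨(u, v'), Finset.mem_filter.2 ⟨hv', ?_⟩, rfl⟩
    simpa using hπ _ _ hlt.le (by simpa using hv.1)

theorem mainTheorem3 :
    ∃ C : ℝ, 0 < C ∧
      ∀ (U V : Type*) [Fintype U] [Fintype V] [Nonempty U] (G : SimpleGraph (U ⊕ V))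
        [G.LocallyFinite] (d : ℕ),
        1 ≤ d → G ≤ completeBipartiteGraph U V → G.IsRegularOfDegree d →
          5 / 9 - C / Real.sqrt d ≤ maxMinGreedyRatio G := by
  refine ⟨2 / 3, by norm_num, ?_⟩
  intro U V _ _ _ G _ d hd hG hreg
  classical
  have hd0 : (0 : ℝ) < d := by exact_mod_cast hd
  set a : U → V → ℝ := fun u v => if G.Adj (Sum.inl u) (Sum.inr v) then 1 else 0 with ha
  have ha0 : ∀ u v, 0 ≤ a u v := fun u v => by simp only [ha]; split_ifs <;> norm_num
  have hrow : ∀ u, ∑ v, a u v = d := fun u => by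
    rw [← hreg (Sum.inl u)]; exact sum_adj_right_eq_degree hG u
  have hcol : ∀ v, ∑ u, a u v = d := fun v => by
    rw [← hreg (Sum.inr v)]; exact sum_adj_left_eq_degree hG v
  have hcard : Fintype.card U = Fintype.card V := by
    have h : ∑ u, ∑ v, a u v = ∑ v, ∑ u, a u v := Finset.sum_comm
    simp only [hrow, hcol, Finset.sum_const, Finset.card_univ, nsmul_eq_mul] at h
    exact_mod_cast mul_right_cancel₀ hd0.ne' h
  set n := Fintype.card V with hn
  have hn0 : (0 : ℝ) < n := by
    rw [← hcard]; exact_mod_cast Fintype.card_pos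
  obtain ⟨ε, hε, hle⟩ := exists_signs_sum_sq_le a Finset.univ
  set D : U → ℝ := fun u => |∑ v, a u v * ε v| / 2 with hDdef
  have hD : ∀ u, 0 ≤ D u := fun u => by positivity
  have hsq : ∑ u, |∑ v, a u v * ε v| ^ 2 ≤ n * d := by
    have h : ∑ u, ∑ v, a u v ^ 2 = n * d := by
      have : ∀ u v, a u v ^ 2 = a u v := fun u v => by simp only [ha]; split_ifs <;> norm_num
      simp [this, hrow, hcard]
    simpa [h] using hle
  have hsum : ∑ u, D u ≤ n * Real.sqrt d / 2 := by
    rw [hDdef, ← Finset.sum_div]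
    gcongr
    refine abs_le_of_sq_le_sq' ?_ (by positivity) |>.2
    calc (∑ u, |∑ v, a u v * ε v|) ^ 2
        ≤ (Finset.univ : Finset U).card * ∑ u, |∑ v, a u v * ε v| ^ 2 :=
          sq_sum_le_card_mul_sum_sq
      _ ≤ n * (n * d) := by rw [Finset.card_univ, hcard]; gcongr
      _ = (n * Real.sqrt d) ^ 2 := by rw [mul_pow, Real.sq_sqrt hd0.le]; ring
  -- Positions are sorted by `-ε`, so that the vertices of sign `1` come first.
  obtain ⟨π, hπ⟩ := exists_equiv_monotone_comp fun v => -ε v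
  have hW : ∀ u, ∑ v ∈ Finset.univ.filter (ε · = 1), a u v ≤ d / 2 + D u := by
    intro u
    have h : ∑ v ∈ Finset.univ.filter (ε · = 1), a u v
        = (∑ v, a u v + ∑ v, a u v * ε v) / 2 := by
      rw [Finset.sum_filter, ← Finset.sum_add_distrib, Finset.sum_div]
      refine Finset.sum_congr rfl fun v _ => ?_
      rcases hε v with h | h <;> rw [h] <;> norm_num
    rw [h, hrow, hDdef]
    have := le_abs_self (∑ v, a u v * ε v)
    dsimp only
    linarith
  have hW' : ∀ u, ∑ v ∈ Finset.univ.filter (ε · ≠ 1), a u v ≤ d / 2 + D u := by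
    intro u
    have h : ∑ v ∈ Finset.univ.filter (ε · ≠ 1), a u v
        = (∑ v, a u v - ∑ v, a u v * ε v) / 2 := by
      rw [Finset.sum_filter, ← Finset.sum_sub_distrib, Finset.sum_div]
      refine Finset.sum_congr rfl fun v _ => ?_
      rcases hε v with h | h <;> rw [h] <;> norm_num
    rw [h, hrow, hDdef]
    have := neg_abs_le (∑ v, a u v * ε v)
    dsimp only
    linarith
  have hinit : ∀ i j, i ≤ j → π j ∈ Finset.univ.filter (ε · = 1) →
      π i ∈ Finset.univ.filter (ε · = 1) := by
    intro i j hij hj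
    simp only [Finset.mem_filter, Finset.mem_univ, true_and] at hj ⊢
    have hmono : -ε (π i) ≤ -ε (π j) := hπ hij
    rcases hε (π i) with h | h
    · exact h
    · linarith
  have hkey : ∀ σ : Fin (Fintype.card U) ≃ U,
      5 / 9 * (n : ℝ) - 4 / 3 * ((∑ u, D u) / d) ≤ (greedyMatching G σ π).card :=
    card_greedyMatching_ge a ha0 (fun u v h => by simp [ha, h]) hd0 hcol hcard hD
      (by simp) hW hW' hinit
  have : Nonempty (Fin (Fintype.card U) ≃ U) := ⟨(Fintype.equivFin U).symm⟩
  obtain ⟨σ, hσ⟩ := exists_eq_ciInf_of_finite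
    (f := fun σ : Fin (Fintype.card U) ≃ U => (greedyMatching G σ π).card)
  have hsup : (greedyMatching G σ π).card ≤ ⨆ π : Fin (Fintype.card V) ≃ V,
      ⨅ σ : Fin (Fintype.card U) ≃ U, (greedyMatching G σ π).card :=
    hσ.le.trans (le_ciSup (f := fun π : Fin (Fintype.card V) ≃ V =>
      ⨅ σ : Fin (Fintype.card U) ≃ U, (greedyMatching G σ π).card)
      (Set.finite_range _).bddAbove π)
  have hsqrt : 0 < Real.sqrt d := Real.sqrt_pos.2 hd0
  have herr : (∑ u, D u) / d ≤ n / (2 * Real.sqrt d) := by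
    rw [div_le_div_iff₀ hd0 (by positivity)]
    calc (∑ u, D u) * (2 * Real.sqrt d) ≤ n * Real.sqrt d / 2 * (2 * Real.sqrt d) := by gcongr
      _ = n * (Real.sqrt d * Real.sqrt d) := by ring
      _ = n * d := by rw [Real.mul_self_sqrt hd0.le]
  unfold maxMinGreedyRatio
  rw [one_div, inv_mul_eq_div, le_div_iff₀ hn0]
  calc (5 / 9 - 2 / 3 / Real.sqrt d) * (n : ℝ)
      = 5 / 9 * n - 4 / 3 * (n / (2 * Real.sqrt d)) := by field_simp; ring
    _ ≤ 5 / 9 * (n : ℝ) - 4 / 3 * ((∑ u, D u) / d) := by gcongr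
    _ ≤ (greedyMatching G σ π).card := hkey σ
    _ ≤ _ := by exact_mod_cast hsup
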